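/- Theorem (Siegel). Let $\Gamma=\mathrm{SL}_2(\mathbb Z)$, let $k$ be an even integer, let $M_k(\Gamma)$ be the space of modular forms of weight $k$ on $\Gamma$, and let $r=\dim_{\mathbb C} M_k(\Gamma)$. Write $q=e^{2\pi i\tau}$, let $\Delta=q\prod_{m\ge1}(1-q^m)^{24}$, and for even $w\ge4$ let $E_w=\frac12\sum_{\gcd(c,d)=1}(c\tau+d)^{-w}=1-\frac{2w}{B_w}\sum_{n\ge1}\sigma_{w-1}(n)q^n$ be the normalized Eisenstein series of weight $w$; set $E_0=1$. (The weight $12r-k+2$ is either $0$ or an even integer $\ge4$.) Define complex numbers $c_i^k$ by the Laurent expansion $$\frac{E_{12r-k+2}}{\Delta^r}=\sum_{i\ge-r}c_i^k\,q^i ,$$ which converges for every $\tau$ in the upper half-plane. Then every $f=\sum_{n\ge0}a(n)q^n\in M_k(\Gamma)$ satisfies $$\sum_{0\le n\le r}c_{-n}^k\,a(n)=0 .$$ If in addition $k\ne0$, then $c_0^k\ne0$, the numbers $c_{-n}^k/c_0^k$ for $1\le n\le r$ are rational, and for every $f=\sum_{n\ge0}a(n)q^n\in M_k(\Gamma)$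 $$a(0)=-\sum_{1\le n\le r}\frac{c_{-n}^k}{c_0^k}\,a(n),$$ so that $a(0)$ is a linear combination of $a(1),\dots,a(r)$ with rational coefficients that depend only on $k$. -/

import Mathlib

open UpperHalfPlane
open scoped MatrixGroups

namespace SiegelRelation

/-- `r = dim M_k(SL(2, ℤ))`. -/
noncomputable def dimM (k : ℤ) : ℕ := Module.finrank ℂ (ModularForm 𝒮ℒ k)

/-- The weight `12 r - k + 2` with `r = dim M_k(SL(2, ℤ))`. -/
noncomputable def weight (k : ℤ) : ℤ := 12 * (dimM k : ℤ) - k + 2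

/-- For even `k` the weight `12 r - k + 2` is `0` or an even integer that is at least `4`. -/
theorem weight_cases {k : ℤ} (hk : Even k) :
    Even (weight k) ∧ (weight k = 0 ∨ 4 ≤ weight k) := by
  refine ⟨?_, ?_⟩
  · obtain ⟨m, rfl⟩ := hk
    exact ⟨6 * (dimM (m + m) : ℤ) - m + 1, by unfold weight; ring⟩
  · rcases lt_or_ge k 0 with h | h
    · right
      obtain ⟨m, rfl⟩ := hk
      unfold weight
      omega
    · lift k to ℕ using h
      have hk' : Even k := by exact_mod_cast hk
      have hd : dimM (k : ℤ) = if k ≡ 2 [MOD 12] then k / 12 else k / 12 + 1 := by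
        unfold dimM Module.finrank
        rw [ModularForm.dimension_level_one k hk']
        exact Cardinal.toNat_natCast.{0} _
      obtain ⟨m, rfl⟩ := hk'
      unfold weight
      rw [hd]
      by_cases h2 : m + m ≡ 2 [MOD 12]
      · rw [if_pos h2]
        unfold Nat.ModEq at h2
        omega
      · rw [if_neg h2]
        unfold Nat.ModEq at h2
        omega

/-- The normalized Eisenstein series
`E_w(τ) = (1/2) ∑_{gcd(c, d) = 1} (c τ + d)^(-w) = 1 - (2w / B_w) ∑_{n ≥ 1} σ_{w-1}(n) q^n`
of even weight `w ≥ 4`, with the convention `E_0 = 1`; other `w` do not occur below. -/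
noncomputable def eisenstein (w : ℤ) : ℍ → ℂ :=
  if h : 3 ≤ w.toNat then ModularForm.E h else 1

/-- The Laurent series in `q` of the quotient `E_{12 r - k + 2} / Δ ^ r`, `r = dim M_k`, that is,
the quotient, in the field of formal Laurent series, of the two `q`-expansions. -/
noncomputable def quotientSeries (k : ℤ) : LaurentSeries ℂ :=
  HahnSeries.ofPowerSeries ℤ ℂ (qExpansion 1 (eisenstein (weight k))) /
    HahnSeries.ofPowerSeries ℤ ℂ (qExpansion 1 ModularForm.discriminant) ^ dimM k

/-- `c k i` is the coefficient of `q ^ i` in `E_{12 r - k + 2} / Δ ^ r`, `r = dim M_k`. -/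
noncomputable def c (k i : ℤ) : ℂ := (quotientSeries k).coeff i

/-- `a f n` is the coefficient of `q ^ n` in the Fourier expansion of `f`. -/
noncomputable def a {k : ℤ} (f : ModularForm 𝒮ℒ k) (n : ℕ) : ℂ := (qExpansion 1 f).coeff n

/-- `q = exp (2 π i τ)`. -/
noncomputable def q (τ : ℍ) : ℂ := Complex.exp (2 * Real.pi * Complex.I * (τ : ℂ))

end SiegelRelation

/-! If `f` has weight `k`, then `f · E_{12r-k+2}` has weight `12r + 2`, so the relation says that `g
/ Δ ^ r` has no constant term when `g` has weight `12r + 2`. Instead of the residue theorem, the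
proof uses induction on `r` (`coeff_mul_discriminantInv_pow_eq_zero`). Subtracting a multiple of `E₄
^ (3r - 1) E₆` makes `g` divisible by `Δ`, which lowers `r`. The subtracted form is harmless because
`E₄ ^ (3r - 1) E₆ / Δ ^ r` is a multiple of the derivative of `(E₄ ^ 3 / Δ) ^ r`, and a derivative
in `q d/dq` has no constant term.

For `c k 0 ≠ 0` with `r > 0`, the weight `12r - k + 2` lies in `{0, 4, 6, 8, 10, 14}`. In weights 0,
4, 8 the quotient is a product of series with positive coefficients, since `E₄` and `q / Δ` are
such. In weights 6, 10, 14 the numerator is `E₄ ^ (n - 1) E₆`. By Ramanujan's identity and `D Δ = E₂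
Δ`, the constant term is a multiple of `n - 3r` times that of `D (E₄ ^ n) / Δ ^ r`, which is
positive (`coeff_e_four_pow_mul_e_six`). The case `n = 3r` is exactly `k = 0`. Rationality holds
because all series involved have rational coefficients. -/

namespace SiegelRelation

open Filter Derivative EisensteinSeries
open scoped PowerSeries ModularForm Manifold Topology

/-! ### Transfer between functions on the upper half-plane and power series in `q`. -/

/-- The function `f` is the sum of the power series `P` in `q`. -/
def HasQSeries (f : ℍ → ℂ) (P : ℂ⟦X⟧) : Prop :=
  ∀ τ : ℍ, HasSum (fun m : ℕ ↦ P.coeff m * q τ ^ m) (f τ)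

/-- The derivation `θ = X d/dX` on power series. -/
noncomputable def theta (K : Type*) [Field K] : Derivation K K⟦X⟧ K⟦X⟧ :=
  (PowerSeries.X : K⟦X⟧) • PowerSeries.derivative K

lemma theta_apply {K : Type*} [Field K] (P : K⟦X⟧) :
    theta K P = PowerSeries.X * PowerSeries.derivative K P := rfl

lemma coeff_theta {K : Type*} [Field K] (P : K⟦X⟧) (n : ℕ) :
    (theta K P).coeff n = n * P.coeff n := by
  rw [theta_apply]
  cases n with
  | zero => simp
  | succ n => simp [PowerSeries.coeff_succ_X_mul, PowerSeries.coeff_derivative, mul_comm]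

lemma q_eq_qParam (τ : ℍ) : q τ = Function.Periodic.qParam 1 τ := by
  simp [q, Function.Periodic.qParam]

lemma q_ne_zero (τ : ℍ) : q τ ≠ 0 := Complex.exp_ne_zero _

lemma hasQSeries_modularForm {k : ℤ} (f : ModularForm 𝒮ℒ k) : HasQSeries f (qExpansion 1 f) := by
  intro τ
  rw [q_eq_qParam]
  exact ModularForm.hasSum_qExpansion f one_pos one_mem_strictPeriods_SL τ

lemma hasQSeries_one : HasQSeries 1 1 := by
  intro τ
  have h := hasSum_single (f := fun m : ℕ ↦ (1 : ℂ⟦X⟧).coeff m * q τ ^ m) 0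
    fun n hn ↦ by simp [PowerSeries.coeff_one, hn]
  simpa using h

lemma hasQSeries_q : HasQSeries q PowerSeries.X := by
  intro τ
  have h := hasSum_single (f := fun m : ℕ ↦ (PowerSeries.X : ℂ⟦X⟧).coeff m * q τ ^ m) 1
    fun n hn ↦ by simp [PowerSeries.coeff_X, hn]
  simpa using h

namespace HasQSeries

variable {f g : ℍ → ℂ} {P Q : ℂ⟦X⟧}

lemma mul (hf : HasQSeries f P) (hg : HasQSeries g Q) : HasQSeries (f * g) (P * Q) := by
  intro τ
  have h := summable_norm_sum_mul_antidiagonal_of_summable_norm (hf τ).summable.norm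
    (hg τ).summable.norm
  have h2 := tsum_mul_tsum_eq_tsum_sum_antidiagonal_of_summable_norm (hf τ).summable.norm
    (hg τ).summable.norm
  rw [(hf τ).tsum_eq, (hg τ).tsum_eq] at h2
  rw [Pi.mul_apply, h2]
  convert! h.of_norm.hasSum using 2 with m
  rw [PowerSeries.coeff_mul, Finset.sum_mul]
  refine Finset.sum_congr rfl fun x hx ↦ ?_
  rw [← Finset.HasAntidiagonal.mem_antidiagonal.mp hx, pow_add]
  ring

lemma pow (hf : HasQSeries f P) (n : ℕ) : HasQSeries (f ^ n) (P ^ n) := by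
  induction n with
  | zero => simpa using hasQSeries_one
  | succ n ih => simpa [pow_succ] using ih.mul hf

lemma sub (hf : HasQSeries f P) (hg : HasQSeries g Q) : HasQSeries (f - g) (P - Q) := fun τ ↦ by
  simpa [sub_mul] using (hf τ).sub (hg τ)

lemma smul (hf : HasQSeries f P) (a : ℂ) : HasQSeries (a • f) (a • P) := fun τ ↦ by
  simpa [mul_assoc] using (hf τ).mul_left a

lemma unique (hf : HasQSeries f P) (hg : HasQSeries f Q) : P = Q := by
  -- Passing to the difference reduces uniqueness to the zero modular form, whose cusp function is
  -- known to be analytic at 0.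
  have h0 : HasQSeries (0 : ModularForm 𝒮ℒ 0) (P - Q) := by simpa using hf.sub hg
  have han : AnalyticAt ℂ (cuspFunction 1 (0 : ModularForm 𝒮ℒ 0)) 0 :=
    ModularFormClass.analyticAt_cuspFunction_zero _ one_pos one_mem_strictPeriods_SL
  ext m
  have h1 := qExpansion_coeff_unique (0 : ModularForm 𝒮ℒ 0) (c := fun m ↦ (P - Q).coeff m)
    one_pos han (fun τ ↦ by simpa [q_eq_qParam] using h0 τ) m
  rw [FunLike.coe_zero, qExpansion_zero, map_sub, map_zero] at h1
  exact sub_eq_zero.mp h1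

lemma isBoundedAtImInfty (hf : HasQSeries f P) : IsBoundedAtImInfty f :=
  isBoundedAtImInfty_of_hasSum_qExpansion (c := fun m ↦ P.coeff m) one_pos
    fun τ ↦ by simpa [q_eq_qParam] using hf τ

/-- Termwise differentiation is legitimate on the half-plane `Im z > y`, because `|q|` there is less
than its value at `σ = iy`, where the series converges absolutely. -/
lemma normalizedDeriv (hf : HasQSeries f P) : HasQSeries (D f) (theta ℂ P) := by
  intro τ
  set y : ℝ := τ.im / 2
  have hy : 0 < y := half_pos τ.im_pos
  let U : Set ℂ := {z | y < z.im}
  have hU : IsOpen U := isOpen_lt continuous_const Complex.continuous_im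
  have hτ : (τ : ℂ) ∈ U := half_lt_self τ.im_pos
  let F : ℕ → ℂ → ℂ := fun m z ↦ P.coeff m * Complex.exp (2 * Real.pi * Complex.I * z) ^ m
  let σ : ℍ := ⟨y * Complex.I, by simpa using hy⟩
  have hF (m : ℕ) (z : ℂ) : HasDerivAt (F m)
      (2 * Real.pi * Complex.I * (m * (P.coeff m * Complex.exp (2 * Real.pi * Complex.I * z) ^ m)))
      z := by
    have h1 : HasDerivAt (fun z : ℂ ↦ Complex.exp (2 * Real.pi * Complex.I * z))
        (Complex.exp (2 * Real.pi * Complex.I * z) * (2 * Real.pi * Complex.I)) z := by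
      simpa using ((hasDerivAt_id z).const_mul (2 * Real.pi * Complex.I)).cexp
    refine ((h1.fun_pow m).const_mul (P.coeff m)).congr_deriv ?_
    cases m with
    | zero => simp
    | succ m => simp [pow_succ]; ring
  have hbound (m : ℕ) (w : ℂ) (hw : w ∈ U) : ‖F m w‖ ≤ ‖P.coeff m * q σ ^ m‖ := by
    simp only [F, norm_mul, norm_pow]
    gcongr
    simp only [q, Complex.norm_exp, σ]
    have : y < w.im := hw
    simp
    nlinarith [Real.pi_pos]
  have hsum := Complex.hasSum_deriv_of_summable_norm (hf σ).summable.norm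
    (fun m ↦ fun z _ ↦ (hF m z).differentiableAt.differentiableWithinAt) hU hbound hτ
  have heq : (fun w ↦ ∑' m, F m w) =ᶠ[𝓝 (τ : ℂ)] f ∘ ofComplex := by
    filter_upwards [hU.mem_nhds hτ] with w hw
    have hw' : 0 < w.im := hy.trans hw
    rw [Function.comp_apply, ofComplex_apply_of_im_pos hw']
    exact (hf ⟨w, hw'⟩).tsum_eq
  rw [heq.deriv_eq] at hsum
  have hc : (2 * Real.pi * Complex.I : ℂ) ≠ 0 := Complex.two_pi_I_ne_zero
  convert! hsum.mul_left (2 * Real.pi * Complex.I)⁻¹ using 2 with m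
  rw [(hF m τ).deriv, coeff_theta, inv_mul_cancel_left₀ hc, mul_assoc]
  rfl

end HasQSeries

/-! ### The series of `E₂`, `Δ` and `q / Δ`. -/

/-- The `q`-series of the Eisenstein series of weight two. -/
noncomputable def e2 : ℚ⟦X⟧ :=
  .mk fun m ↦ if m = 0 then 1 else -24 * (ArithmeticFunction.sigma 1 m : ℚ)

lemma hasQSeries_E2 : HasQSeries E2 (e2.map (algebraMap ℚ ℂ)) := by
  intro τ
  convert! hasSum_qExpansion_E2 τ using 2 with m
  rw [smul_eq_mul, PowerSeries.coeff_map, e2, PowerSeries.coeff_mk]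
  split_ifs <;> simp [q]

lemma mdifferentiable_discriminant : MDiff ModularForm.discriminant := CuspForm.discriminant.holo'

lemma hasQSeries_discriminant :
    HasQSeries ModularForm.discriminant (qExpansion 1 ModularForm.discriminant) := by
  intro τ
  rw [q_eq_qParam]
  exact ModularForm.hasSum_qExpansion CuspForm.discriminant one_pos one_mem_strictPeriods_SL τ

/-- This is 24 times the logarithmic derivative of `η`, since `Δ = η ^ 24`. -/
lemma normalizedDeriv_discriminant :
    D ModularForm.discriminant = E2 * ModularForm.discriminant := by
  ext τ
  have hη := ModularForm.differentiableAt_eta_of_mem_upperHalfPlaneSet τ.2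
  have heq : ModularForm.discriminant ∘ ofComplex =ᶠ[𝓝 (τ : ℂ)] fun z ↦ ModularForm.eta z ^ 24 := by
    filter_upwards [isOpen_upperHalfPlaneSet.mem_nhds τ.2] with z hz
    simp [ModularForm.discriminant, ofComplex_apply_of_im_pos hz]
  have h := ModularForm.logDeriv_eta_eq_E2 τ
  rw [logDeriv_apply, div_eq_iff (ModularForm.eta_ne_zero τ.2)] at h
  have hd := (hη.hasDerivAt.fun_pow 24).deriv
  rw [normalizedDerivOfComplex, heq.deriv_eq, hd, h, Pi.mul_apply, ModularForm.discriminant]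
  have hpi : (Real.pi : ℂ) ≠ 0 := by exact_mod_cast Real.pi_ne_zero
  have := Complex.I_ne_zero
  field_simp
  push_cast
  ring

/-- The `q`-series of `q / Δ`. -/
noncomputable def discriminantInv : ℂ⟦X⟧ := qExpansion 1 (q / ModularForm.discriminant)

lemma mdifferentiable_q : MDiff q := by
  rw [UpperHalfPlane.mdifferentiable_iff]
  refine DifferentiableOn.congr (f := fun z : ℂ ↦ Complex.exp (2 * Real.pi * Complex.I * z))
    (by fun_prop) fun z hz ↦ ?_
  simp [q, ofComplex_apply_of_im_pos hz]

lemma periodic_q_div_discriminant :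
    Function.Periodic ((q / ModularForm.discriminant) ∘ ofComplex) (1 : ℝ) := by
  have h1 : Function.Periodic (ModularForm.discriminant ∘ ofComplex) (1 : ℝ) :=
    SlashInvariantFormClass.periodic_comp_ofComplex CuspForm.discriminant one_mem_strictPeriods_SL
  have h2 : Function.Periodic (q ∘ ofComplex) (1 : ℝ) := by
    intro w
    by_cases! hw : 0 < w.im
    · have hw' : 0 < (w + (1 : ℝ)).im := by simpa using hw
      simp only [Function.comp_apply, ofComplex_apply_of_im_pos hw, ofComplex_apply_of_im_pos hw',
        q, coe_mk]
      rw [Complex.ofReal_one, mul_add, mul_one, Complex.exp_add, Complex.exp_two_pi_mul_I, mul_one]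
    · have hw' : (w + (1 : ℝ)).im ≤ 0 := by simpa using hw
      simp only [Function.comp_apply, ofComplex_apply_of_im_nonpos hw,
        ofComplex_apply_of_im_nonpos hw']
  intro w
  have h1 := h1 w
  have h2 := h2 w
  simp only [Function.comp_apply, Pi.div_apply] at h1 h2 ⊢
  rw [h1, h2]

lemma hasQSeries_discriminantInv : HasQSeries (q / ModularForm.discriminant) discriminantInv := by
  intro τ
  have hbdd : IsBoundedAtImInfty (q / ModularForm.discriminant) := by
    have h : q =O[atImInfty] ModularForm.discriminant := by
      refine .trans (.of_bound 1 (.of_forall fun τ ↦ ?_)) ModularForm.exp_isBigO_discriminant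
      simp [q, Complex.norm_exp]
    exact (Asymptotics.div_isBoundedUnder_of_isBigO h).isBigO_one ℝ
  have hdiff : MDiff (q / ModularForm.discriminant) :=
    mdifferentiable_q.div mdifferentiable_discriminant ModularForm.discriminant_ne_zero
  have h := hasSum_qExpansion one_pos periodic_q_div_discriminant hdiff hbdd τ
  rw [← q_eq_qParam] at h
  exact h

lemma discriminant_mul_inv :
    qExpansion 1 ModularForm.discriminant * discriminantInv = PowerSeries.X := by
  have h := hasQSeries_discriminant.mul hasQSeries_discriminantInv
  have heq : ModularForm.discriminant * (q / ModularForm.discriminant) = q := by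
    ext τ
    exact mul_div_cancel₀ _ (ModularForm.discriminant_ne_zero τ)
  exact (heq ▸ h).unique hasQSeries_q

/-- Logarithmic derivative of `q / Δ`: `q` contributes 1 and `Δ` contributes `E₂`. As `1 - E₂ = 24 ∑
σ₁(n) qⁿ`, this is a recursion with positive terms for the coefficients. -/
lemma theta_discriminantInv :
    theta ℂ discriminantInv = (1 - e2.map (algebraMap ℚ ℂ)) * discriminantInv := by
  have hΔ : theta ℂ (qExpansion 1 ModularForm.discriminant) =
      e2.map (algebraMap ℚ ℂ) * qExpansion 1 ModularForm.discriminant :=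
    (normalizedDeriv_discriminant ▸ hasQSeries_discriminant.normalizedDeriv).unique
      (hasQSeries_E2.mul hasQSeries_discriminant)
  have hX : theta ℂ PowerSeries.X = PowerSeries.X := by simp [theta_apply]
  have h := congrArg (theta ℂ) discriminant_mul_inv
  rw [Derivation.leibniz, hΔ, hX, smul_eq_mul, smul_eq_mul] at h
  have h0 : qExpansion 1 ModularForm.discriminant ≠ 0 := fun h0 ↦ by
    have := discriminant_mul_inv
    simp [h0, PowerSeries.X_ne_zero.symm] at this
  refine mul_left_cancel₀ h0 ?_
  linear_combination h - discriminant_mul_inv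

lemma coeff_zero_discriminantInv : discriminantInv.coeff 0 = 1 := by
  have h0 : (qExpansion 1 ModularForm.discriminant).coeff 0 = 0 :=
    CuspFormClass.qExpansion_coeff_zero CuspForm.discriminant one_pos one_mem_strictPeriods_SL
  have h := congrArg (PowerSeries.coeff 1) discriminant_mul_inv
  rw [PowerSeries.coeff_mul] at h
  simpa [Finset.Nat.antidiagonal_succ, h0, ModularForm.discriminant_qExpansion_coeff_one,
    -PowerSeries.coeff_zero_eq_constantCoeff] using h

/-- The coefficients of the `q`-series of `q / Δ` are positive rational numbers. -/
lemma exists_pos_discriminantInv :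
    ∃ v : ℚ⟦X⟧, v.map (algebraMap ℚ ℂ) = discriminantInv ∧ ∀ n, 0 < v.coeff n := by
  have key (n : ℕ) : ∃ r : ℚ, 0 < r ∧ (r : ℂ) = discriminantInv.coeff n := by
    induction n using Nat.strong_induction_on with | _ n ih =>
    rcases n with _ | n
    · exact ⟨1, one_pos, by rw [coeff_zero_discriminantInv, Rat.cast_one]⟩
    choose! r hr hr' using ih
    refine ⟨(∑ i ∈ Finset.range (n + 1),
      24 * (ArithmeticFunction.sigma 1 (i + 1) : ℚ) * r (n - i)) / (n + 1 : ℕ), ?_, ?_⟩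
    · refine div_pos (Finset.sum_pos (fun i hi ↦ ?_) (by simp)) (by positivity)
      have h1 : 0 < r (n - i) := hr _ (by omega)
      have h2 : 0 < ArithmeticFunction.sigma 1 (i + 1) :=
        ArithmeticFunction.sigma_pos _ _ (by omega)
      positivity
    -- The term `i = 0` is split off and vanishes because `1 - E₂` has no constant term, so only
    -- earlier coefficients remain on the right.
    · have h := congrArg (PowerSeries.coeff (n + 1)) theta_discriminantInv
      rw [coeff_theta, PowerSeries.coeff_mul, Finset.Nat.sum_antidiagonal_eq_sum_range_succ
        (fun i j ↦ (1 - e2.map (algebraMap ℚ ℂ)).coeff i * discriminantInv.coeff j),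
        Finset.sum_range_succ'] at h
      have hn : ((n + 1 : ℕ) : ℂ) ≠ 0 := Nat.cast_ne_zero.mpr n.succ_ne_zero
      rw [Rat.cast_div, Rat.cast_natCast, div_eq_iff hn, mul_comm _ ((n + 1 : ℕ) : ℂ), h]
      simp only [e2, map_sub, PowerSeries.coeff_one, PowerSeries.coeff_map, PowerSeries.coeff_mk,
        if_true, map_one, sub_self, zero_mul, add_zero, Rat.cast_sum, Nat.add_eq_zero_iff,
        one_ne_zero, and_false, if_false]
      refine Finset.sum_congr rfl fun i hi ↦ ?_
      rw [show n + 1 - (i + 1) = n - i by omega, Rat.cast_mul, hr' _ (by omega)]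
      simp
  choose r hr hr' using key
  exact ⟨.mk r, by ext n; simp [hr'], by simpa using hr⟩

/-! ### Rational Eisenstein series and identities in one-dimensional weights. -/

/-- The `q`-series of the Eisenstein series of even weight `k ≥ 4`, with rational coefficients. -/
noncomputable def e (k : ℕ) : ℚ⟦X⟧ :=
  .mk fun m ↦ if m = 0 then 1 else -(2 * k / bernoulli k) * (ArithmeticFunction.sigma (k - 1) m : ℚ)

lemma map_e {k : ℕ} (hk : 3 ≤ k) (hk2 : Even k) :
    (e k).map (algebraMap ℚ ℂ) = qExpansion 1 (ModularForm.E hk) := by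
  ext m
  rw [E_qExpansion_coeff hk hk2, PowerSeries.coeff_map, e, PowerSeries.coeff_mk]
  split_ifs <;> simp

lemma coeff_zero_e (k : ℕ) : (e k).coeff 0 = 1 := by simp [e]

lemma constantCoeff_e (k : ℕ) : (e k).constantCoeff = 1 := by
  rw [← PowerSeries.coeff_zero_eq_constantCoeff_apply, coeff_zero_e]

lemma constantCoeff_e2 : e2.constantCoeff = 1 := by
  rw [← PowerSeries.coeff_zero_eq_constantCoeff_apply, e2, PowerSeries.coeff_mk, if_pos rfl]

/-- The Bernoulli number `B₄` is negative, so the factor `-8 / B₄ = 240` is positive. -/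
lemma coeff_e_four_pos (n : ℕ) : 0 < (e 4).coeff n := by
  rw [e, PowerSeries.coeff_mk, show bernoulli 4 = -1 / 30 by decide +kernel]
  split_ifs with h
  · exact one_pos
  · have h2 : 0 < ArithmeticFunction.sigma (4 - 1) n := ArithmeticFunction.sigma_pos _ _ h
    exact mul_pos (by norm_num) (by exact_mod_cast h2)

lemma finrank_modularForm_eq_one {k : ℕ} (hk : k ∈ ({6, 8, 10, 14} : Finset ℕ)) :
    Module.finrank ℂ (ModularForm 𝒮ℒ k) = 1 := by
  rw [← Module.rank_eq_one_iff_finrank_eq_one]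
  fin_cases hk
  all_goals
    rw [ModularForm.dimension_level_one _ (by decide)]
    simp [Nat.ModEq]

lemma qExpansion_eq_smul_e {k : ℕ} (hk : k ∈ ({6, 8, 10, 14} : Finset ℕ))
    (f : ModularForm 𝒮ℒ k) :
    qExpansion 1 f = (qExpansion 1 f).coeff 0 • (e k).map (algebraMap ℚ ℂ) := by
  have hk3 : 3 ≤ k := by fin_cases hk <;> norm_num
  have hk2 : Even k := by fin_cases hk <;> decide
  obtain ⟨c, rfl⟩ := (finrank_eq_one_iff_of_nonzero' (ModularForm.E hk3) (E_ne_zero hk3 hk2)).mp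
    (finrank_modularForm_eq_one hk) f
  rw [FunLike.coe_smul, ModularForm.qExpansion_smul one_pos one_mem_strictPeriods_SL,
    PowerSeries.coeff_smul, E_qExpansion_coeff_zero hk3 hk2, map_e hk3 hk2, smul_eq_mul, mul_one]

lemma map_injective : Function.Injective (PowerSeries.map (algebraMap ℚ ℂ)) :=
  PowerSeries.map_injective _ (algebraMap ℚ ℂ).injective

lemma qExpansion_E₄ : qExpansion 1 ModularForm.E₄ = (e 4).map (algebraMap ℚ ℂ) :=
  (map_e _ (by decide)).symm

lemma qExpansion_E₆ : qExpansion 1 ModularForm.E₆ = (e 6).map (algebraMap ℚ ℂ) :=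
  (map_e _ (by decide)).symm

lemma e_eq_of_qExpansion {k : ℕ} (hk : k ∈ ({6, 8, 10, 14} : Finset ℕ)) (f : ModularForm 𝒮ℒ k)
    (P : ℚ⟦X⟧) (hP : P.coeff 0 = 1) (hf : qExpansion 1 f = P.map (algebraMap ℚ ℂ)) : e k = P := by
  have h := qExpansion_eq_smul_e hk f
  rw [hf, PowerSeries.coeff_map, hP, map_one, one_smul] at h
  exact map_injective h.symm

lemma e_eight : e 8 = e 4 ^ 2 := by
  refine e_eq_of_qExpansion (by decide) (ModularForm.E₄.pow 2) _
    (by simp [constantCoeff_e]) ?_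
  rw [ModularForm.qExpansion_pow one_pos one_mem_strictPeriods_SL, qExpansion_E₄, map_pow]

lemma e_ten : e 10 = e 4 * e 6 := by
  refine e_eq_of_qExpansion (by decide) (ModularForm.E₄.mul ModularForm.E₆) _ ?_ ?_
  · simp [constantCoeff_e]
  rw [ModularForm.qExpansion_mul one_pos one_mem_strictPeriods_SL, qExpansion_E₄, qExpansion_E₆,
    map_mul]

lemma e_fourteen : e 14 = e 4 ^ 2 * e 6 := by
  refine e_eq_of_qExpansion (by decide) ((ModularForm.E₄.pow 2).mul ModularForm.E₆) _ ?_ ?_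
  · simp [constantCoeff_e]
  rw [ModularForm.qExpansion_mul one_pos one_mem_strictPeriods_SL,
    ModularForm.qExpansion_pow one_pos one_mem_strictPeriods_SL, qExpansion_E₄, qExpansion_E₆,
    map_mul, map_pow]

/-! ### The Serre derivative of `E₄` and Ramanujan's identity. -/

lemma hasQSeries_serreDerivative_E₄ : HasQSeries (serreDerivative (4 : ℤ) ModularForm.E₄)
    ((theta ℚ (e 4) - (1 / 3 : ℚ) • (e2 * e 4)).map (algebraMap ℚ ℂ)) := by
  have h4 := hasQSeries_modularForm ModularForm.E₄
  have h := h4.normalizedDeriv.sub ((hasQSeries_E2.mul h4).smul (1 / 3 : ℂ))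
  convert h using 1
  · ext τ
    simp only [serreDerivative_apply, Pi.sub_apply, Pi.smul_apply, Pi.mul_apply, smul_eq_mul]
    push_cast
    ring
  · rw [qExpansion_E₄]
    ext m
    simp [coeff_theta, ← map_mul]

/-- The Serre derivative of `E₄` as a modular form of weight six. -/
noncomputable def serreDerivativeE₄ : ModularForm 𝒮ℒ 6 where
  toFun := serreDerivative (4 : ℤ) ModularForm.E₄
  slash_action_eq' := by
    rintro _ ⟨γ, rfl⟩
    exact serreDerivative_slash_invariant (k := 4) ModularForm.E₄.holo'
      (ModularForm.E₄.slash_action_eq' _ ⟨γ, rfl⟩)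
  holo' := serreDerivative_mdifferentiable _ ModularForm.E₄.holo'
  bdd_at_cusps' {c} hc := by
    rw [Subgroup.IsArithmetic.isCusp_iff_isCusp_SL2Z] at hc
    rw [OnePoint.isBoundedAt_iff_forall_SL2Z hc]
    intro γ _
    -- Invariance under the full modular group reduces every cusp to infinity, where the `q`-series
    -- gives boundedness.
    have h : serreDerivative (4 : ℤ) ModularForm.E₄ ∣[(6 : ℤ)] γ =
        serreDerivative (4 : ℤ) ModularForm.E₄ :=
      serreDerivative_slash_invariant (k := 4) ModularForm.E₄.holo'
        (ModularForm.E₄.slash_action_eq' _ ⟨γ, rfl⟩)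
    exact (congrArg IsBoundedAtImInfty h).mpr
      hasQSeries_serreDerivative_E₄.isBoundedAtImInfty

/-- Ramanujan's identity for the derivative of `E₄`. -/
lemma three_mul_theta_e_four : 3 * theta ℚ (e 4) = e2 * e 4 - e 6 := by
  have h1 : qExpansion 1 serreDerivativeE₄ = _ :=
    (hasQSeries_modularForm serreDerivativeE₄).unique hasQSeries_serreDerivative_E₄
  have h2 := qExpansion_eq_smul_e (k := 6) (by decide) serreDerivativeE₄
  -- Weight 6 is one-dimensional, so this constant term determines the multiple of `E₆`.
  have h3 : (theta ℚ (e 4) - (1 / 3 : ℚ) • (e2 * e 4)).coeff 0 = -(1 / 3) := by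
    rw [map_sub, coeff_theta, PowerSeries.coeff_smul]
    simp [constantCoeff_e, constantCoeff_e2]
  erw [h1] at h2
  rw [PowerSeries.coeff_map, h3] at h2
  have h4 : theta ℚ (e 4) - (1 / 3 : ℚ) • (e2 * e 4) = (-(1 / 3) : ℚ) • e 6 := by
    apply map_injective
    rw [h2]
    ext m
    simp
  ext m
  have h5 := congrArg (PowerSeries.coeff m) h4
  simp only [map_sub, PowerSeries.coeff_smul, smul_eq_mul] at h5
  rw [show (3 : ℚ⟦X⟧) = PowerSeries.C 3 from (map_ofNat _ 3).symm, PowerSeries.coeff_C_mul,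
    map_sub]
  linear_combination 3 * h5

/-! ### Constant terms of quotients by `Δ ^ r`. -/

/-- The coefficients of the `q`-series of `q / Δ`. -/
noncomputable def v : ℚ⟦X⟧ := exists_pos_discriminantInv.choose

lemma map_v : v.map (algebraMap ℚ ℂ) = discriminantInv := exists_pos_discriminantInv.choose_spec.1

lemma coeff_v_pos (n : ℕ) : 0 < v.coeff n := exists_pos_discriminantInv.choose_spec.2 n

lemma theta_v : theta ℚ v = (1 - e2) * v := by
  apply map_injective
  rw [map_mul, map_v, map_sub, map_one, ← theta_discriminantInv, ← map_v]
  ext n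
  simp [coeff_theta]

/-- The coefficient of `q ^ 0` in `E₄ ^ (n - 1) E₆ / Δ ^ r`, up to a scalar, is the one in
`D (E₄ ^ n) / Δ ^ r`. -/
lemma coeff_e_four_pow_mul_e_six {n r : ℕ} (hn : n ≠ 0) (hr : r ≠ 0) :
    n * (r * (e 4 ^ (n - 1) * e 6 * v ^ r).coeff r) =
      (n - 3 * r) * (theta ℚ (e 4 ^ n) * v ^ r).coeff r := by
  obtain ⟨n, rfl⟩ := Nat.exists_eq_succ_of_ne_zero hn
  obtain ⟨r, rfl⟩ := Nat.exists_eq_succ_of_ne_zero hr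
  have h4 := three_mul_theta_e_four
  have hA : theta ℚ (e 4 ^ (n + 1)) = ((n : ℚ⟦X⟧) + 1) * e 4 ^ n * theta ℚ (e 4) := by
    rw [Derivation.leibniz_pow]
    simp [mul_assoc]
  have hB : theta ℚ (v ^ (r + 1)) = ((r : ℚ⟦X⟧) + 1) * (1 - e2) * v ^ (r + 1) := by
    rw [Derivation.leibniz_pow, theta_v]
    simp [pow_succ]
    ring
  have hAB := (theta ℚ).leibniz (e 4 ^ (n + 1)) (v ^ (r + 1))
  rw [smul_eq_mul, smul_eq_mul] at hAB
  -- The last summand has the form `(r + 1) P - θ P`, which is `-D` of `q ^ (-(r + 1)) P` up to the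
  -- shift. Its coefficient at `r + 1` is therefore zero, and the desired identity remains.
  have hkey : ((n : ℚ⟦X⟧) + 1) * (((r : ℚ⟦X⟧) + 1) * (e 4 ^ n * e 6 * v ^ (r + 1))) =
      (((n : ℚ⟦X⟧) + 1) * (theta ℚ (e 4 ^ (n + 1)) * v ^ (r + 1)) -
        3 * (((r : ℚ⟦X⟧) + 1) * (theta ℚ (e 4 ^ (n + 1)) * v ^ (r + 1)))) +
      ((n : ℚ⟦X⟧) + 1) * (((r : ℚ⟦X⟧) + 1) * (e 4 ^ (n + 1) * v ^ (r + 1)) -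
        theta ℚ (e 4 ^ (n + 1) * v ^ (r + 1))) := by
    rw [hAB, hB, hA, pow_succ (e 4)]
    linear_combination (((n : ℚ⟦X⟧) + 1) * (r + 1) * e 4 ^ n * v ^ (r + 1)) * h4
  have hC (m : ℕ) (P : ℚ⟦X⟧) : ((m : ℚ⟦X⟧) + 1) * P = ((m : ℚ) + 1) • P := by
    ext i
    rw [show (m : ℚ⟦X⟧) + 1 = PowerSeries.C ((m : ℚ) + 1) by simp, PowerSeries.coeff_C_mul,
      PowerSeries.coeff_smul, smul_eq_mul]
  have h3 (P : ℚ⟦X⟧) : (3 : ℚ⟦X⟧) * P = (3 : ℚ) • P := by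
    ext i
    rw [show (3 : ℚ⟦X⟧) = PowerSeries.C 3 from (map_ofNat _ 3).symm, PowerSeries.coeff_C_mul,
      PowerSeries.coeff_smul, smul_eq_mul]
  have h := congrArg (PowerSeries.coeff (r + 1)) hkey
  simp only [mul_assoc, h3, hC, map_add, map_sub, PowerSeries.coeff_smul, smul_eq_mul,
    coeff_theta] at h
  simp only [Nat.succ_eq_add_one, Nat.add_sub_cancel]
  push_cast at h ⊢
  simp only [mul_assoc]
  linear_combination h

lemma coeff_e_four_pow_mul_e_six_eq_zero {r : ℕ} (hr : r ≠ 0) :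
    (e 4 ^ (3 * r - 1) * e 6 * v ^ r).coeff r = 0 := by
  have h := coeff_e_four_pow_mul_e_six (n := 3 * r) (r := r) (by omega) hr
  have hr' : (r : ℚ) ≠ 0 := Nat.cast_ne_zero.mpr hr
  push_cast at h
  rw [sub_self, zero_mul] at h
  simpa [hr'] using h

/-- The constant term of `g / Δ ^ r` vanishes for a modular form `g` of weight `12 r + 2`. -/
lemma coeff_mul_discriminantInv_pow_eq_zero {k : ℤ} (r : ℕ) (hk : k = 12 * r + 2)
    (g : ModularForm 𝒮ℒ k) : (qExpansion 1 g * discriminantInv ^ r).coeff r = 0 := by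
  induction r generalizing k with
  | zero =>
    obtain rfl : k = 2 := by simpa using hk
    rw [rank_zero_iff_forall_zero.mp ModularForm.levelOne_weight_two_rank_zero g, FunLike.coe_zero,
      qExpansion_zero, zero_mul, map_zero]
  | succ r ih =>
    -- The exponent `3r + 2 = 3(r + 1) - 1` is the one for which the quotient by `Δ ^ (r + 1)` is an
    -- exact derivative.
    let b : ModularForm 𝒮ℒ k := ModularForm.mcast (by subst hk; push_cast; ring)
      ((ModularForm.E₄.pow (3 * r + 2)).mul ModularForm.E₆)
    have hb : qExpansion 1 b = (e 4 ^ (3 * (r + 1) - 1) * e 6).map (algebraMap ℚ ℂ) := by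
      rw [ModularForm.qExpansion_mcast, ModularForm.qExpansion_mul one_pos one_mem_strictPeriods_SL,
        ModularForm.qExpansion_pow one_pos one_mem_strictPeriods_SL, qExpansion_E₄, qExpansion_E₆,
        map_mul, map_pow, show 3 * (r + 1) - 1 = 3 * r + 2 by omega]
    set α := (qExpansion 1 g).coeff 0 with hα
    have hq : qExpansion 1 (g - α • b : ModularForm 𝒮ℒ k) =
        qExpansion 1 g - α • qExpansion 1 b := by
      rw [FunLike.coe_sub, ModularForm.qExpansion_sub one_pos one_mem_strictPeriods_SL,
        FunLike.coe_smul, ModularForm.qExpansion_smul one_pos one_mem_strictPeriods_SL]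
    have h0 : (qExpansion 1 (g - α • b : ModularForm 𝒮ℒ k)).coeff 0 = 0 := by
      rw [hq, map_sub, PowerSeries.coeff_smul, hb, ← hα, PowerSeries.coeff_map]
      simp [constantCoeff_e]
    have hΔ := ModularForm.qExpansion_eq_qExpansion_discriminant_mul _ h0
    have hih := ih (by subst hk; push_cast; ring)
      (CuspForm.discriminantEquiv (ModularForm.toCuspForm _ h0))
    set H := qExpansion 1 (CuspForm.discriminantEquiv (ModularForm.toCuspForm _ h0))
    -- The factor `Δ` split off from `g - α b` cancels one factor `q / Δ` and leaves `X`, which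
    -- shifts the index to the one in the induction hypothesis.
    have hg : qExpansion 1 g * discriminantInv ^ (r + 1) =
        PowerSeries.X * (H * discriminantInv ^ r) +
        α • (e 4 ^ (3 * (r + 1) - 1) * e 6 * v ^ (r + 1)).map (algebraMap ℚ ℂ) := by
      rw [map_mul, ← hb, map_pow, map_v, sub_eq_iff_eq_add.mp (hq.symm.trans hΔ),
        ← discriminant_mul_inv, ← smul_mul_assoc]
      ring
    rw [hg, map_add, PowerSeries.coeff_succ_X_mul, hih, PowerSeries.coeff_smul,
      PowerSeries.coeff_map, coeff_e_four_pow_mul_e_six_eq_zero r.succ_ne_zero]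
    simp

/-! ### The Laurent coefficients as shifted power series coefficients. -/

/-- `E_{12 r - k + 2} / Δ ^ r`, multiplied by `q ^ r`, as a power series in `q`. -/
noncomputable def quotientPowerSeries (k : ℤ) : ℂ⟦X⟧ :=
  qExpansion 1 (eisenstein (weight k)) * discriminantInv ^ dimM k

lemma quotientSeries_eq (k : ℤ) : quotientSeries k =
    HahnSeries.single (-(dimM k : ℤ)) 1 * HahnSeries.ofPowerSeries ℤ ℂ (quotientPowerSeries k) := by
  have h : (HahnSeries.ofPowerSeries ℤ ℂ (qExpansion 1 ModularForm.discriminant)) ^ dimM k *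
      HahnSeries.ofPowerSeries ℤ ℂ discriminantInv ^ dimM k =
      HahnSeries.single (dimM k : ℤ) 1 := by
    rw [← mul_pow, ← map_mul, discriminant_mul_inv, ← map_pow, HahnSeries.ofPowerSeries_X_pow]
  have hs : HahnSeries.single (-(dimM k : ℤ)) (1 : ℂ) * HahnSeries.single (dimM k : ℤ) 1 = 1 := by
    rw [HahnSeries.single_mul_single, neg_add_cancel, mul_one, HahnSeries.single_zero_one]
  have hΔ : (HahnSeries.ofPowerSeries ℤ ℂ (qExpansion 1 ModularForm.discriminant)) ^ dimM k ≠ 0 :=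
    fun h0 ↦ by
      rw [← h, h0, zero_mul, mul_zero] at hs
      exact zero_ne_one hs
  rw [quotientSeries, div_eq_iff hΔ, quotientPowerSeries, map_mul, map_pow]
  linear_combination (-HahnSeries.ofPowerSeries ℤ ℂ (qExpansion 1 (eisenstein (weight k)))) * hs -
    HahnSeries.ofPowerSeries ℤ ℂ (qExpansion 1 (eisenstein (weight k))) *
      HahnSeries.single (-(dimM k : ℤ)) 1 * h

lemma c_eq (k : ℤ) (m : ℕ) : c k ((m : ℤ) - dimM k) = (quotientPowerSeries k).coeff m := by
  rw [c, quotientSeries_eq, sub_eq_add_neg, HahnSeries.coeff_single_mul_add, one_mul,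
    HahnSeries.ofPowerSeries_apply_coeff]

lemma c_neg_eq (k : ℤ) {n : ℕ} (hn : n ≤ dimM k) :
    c k (-(n : ℤ)) = (quotientPowerSeries k).coeff (dimM k - n) := by
  rw [← c_eq, Nat.cast_sub hn, sub_sub_cancel_left]

lemma eisenstein_natCast {w : ℕ} (hw : 3 ≤ w) : eisenstein w = ModularForm.E hw := by
  rw [eisenstein, dif_pos (by simpa using hw)]

lemma eisenstein_zero : eisenstein 0 = 1 := by
  rw [eisenstein, dif_neg (by simp)]

/-- `E_{12 r - k + 2}` as a modular form. -/
lemma exists_modularForm_eq_eisenstein {k : ℤ} (hk : Even k) :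
    ∃ g : ModularForm 𝒮ℒ (weight k), (g : ℍ → ℂ) = eisenstein (weight k) := by
  rcases (weight_cases hk).2 with h | h
  · rw [h]
    exact ⟨1, by rw [eisenstein_zero]; rfl⟩
  · generalize weight k = w at h
    lift w to ℕ using by omega
    exact ⟨ModularForm.E (by omega), (eisenstein_natCast _).symm⟩

lemma exists_map_eq_qExpansion_eisenstein {k : ℤ} (hk : Even k) :
    ∃ P : ℚ⟦X⟧, P.map (algebraMap ℚ ℂ) = qExpansion 1 (eisenstein (weight k)) := by
  obtain ⟨h1, h⟩ := weight_cases hk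
  generalize weight k = w at h h1
  rcases h with rfl | h
  · exact ⟨1, by rw [eisenstein_zero, qExpansion_one, map_one]⟩
  · lift w to ℕ using by omega
    refine ⟨e w, ?_⟩
    rw [map_e (by omega) (by exact_mod_cast h1), eisenstein_natCast]

lemma exists_map_eq_quotientPowerSeries {k : ℤ} (hk : Even k) :
    ∃ P : ℚ⟦X⟧, P.map (algebraMap ℚ ℂ) = quotientPowerSeries k := by
  obtain ⟨P, hP⟩ := exists_map_eq_qExpansion_eisenstein hk
  exact ⟨P * v ^ dimM k, by rw [map_mul, map_pow, map_v, hP, quotientPowerSeries]⟩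

/-! ### Positivity and non-vanishing of the constant term. -/

lemma coeff_mul_pos {P Q : ℚ⟦X⟧} (hP : ∀ n, 0 < P.coeff n) (hQ : ∀ n, 0 < Q.coeff n) (n : ℕ) :
    0 < (P * Q).coeff n := by
  rw [PowerSeries.coeff_mul]
  exact Finset.sum_pos (fun x _ ↦ mul_pos (hP _) (hQ _)) ⟨(0, n), by simp⟩

lemma coeff_pow_pos {P : ℚ⟦X⟧} (hP : ∀ n, 0 < P.coeff n) {r : ℕ} (hr : r ≠ 0) (n : ℕ) :
    0 < (P ^ r).coeff n := by
  induction r, Nat.one_le_iff_ne_zero.mpr hr using Nat.le_induction generalizing n with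
  | base => simpa using hP n
  | succ r hr' ih => exact pow_succ P r ▸ coeff_mul_pos (ih (by omega)) hP n

lemma coeff_theta_e_four_pow_mul_pos {n r : ℕ} (hn : n ≠ 0) (hr : r ≠ 0) :
    0 < (theta ℚ (e 4 ^ n) * v ^ r).coeff r := by
  have h4 := coeff_pow_pos coeff_e_four_pos hn
  have hv := coeff_pow_pos coeff_v_pos hr
  rw [PowerSeries.coeff_mul]
  refine Finset.sum_pos' (fun x _ ↦ ?_) ⟨(r, 0), by simp, ?_⟩
  · rw [coeff_theta]
    exact mul_nonneg (mul_nonneg (Nat.cast_nonneg _) (h4 _).le) (hv _).le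
  · rw [coeff_theta]
    exact mul_pos (mul_pos (Nat.cast_pos.mpr (Nat.pos_of_ne_zero hr)) (h4 _)) (hv _)

lemma coeff_e_four_pow_mul_e_six_ne_zero {n r : ℕ} (hr : r ≠ 0) (hnr : n + 1 ≠ 3 * r) :
    (e 4 ^ n * e 6 * v ^ r).coeff r ≠ 0 := fun h ↦ by
  have h1 := coeff_e_four_pow_mul_e_six n.succ_ne_zero hr
  rw [Nat.succ_eq_add_one, Nat.add_sub_cancel, h, mul_zero, mul_zero] at h1
  rcases mul_eq_zero.mp h1.symm with h2 | h2
  · exact hnr (by exact_mod_cast sub_eq_zero.mp h2)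
  · exact (coeff_theta_e_four_pow_mul_pos n.succ_ne_zero hr).ne' h2

lemma dimM_of_neg {k : ℤ} (hk : k < 0) : dimM k = 0 := by
  rw [dimM, Module.finrank, ModularForm.levelOne_neg_weight_rank_zero hk, map_zero]

lemma dimM_natCast {k : ℕ} (hk : Even k) :
    dimM k = if k ≡ 2 [MOD 12] then k / 12 else k / 12 + 1 := by
  rw [dimM, Module.finrank, ModularForm.dimension_level_one k hk]
  exact Cardinal.toNat_natCast.{0} _

lemma quotientPowerSeries_eq_map {k : ℤ} {w : ℕ} (hw : 3 ≤ w) (hw2 : Even w) (h : weight k = w) :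
    quotientPowerSeries k = (e w * v ^ dimM k).map (algebraMap ℚ ℂ) := by
  rw [quotientPowerSeries, h, eisenstein_natCast hw, map_mul, map_pow, map_v, map_e hw hw2]

/-- The constant term of `E_{12 r - k + 2} / Δ ^ r` is not zero. -/
lemma coeff_quotientPowerSeries_ne_zero {k : ℤ} (hk : Even k) (hk0 : k ≠ 0) :
    (quotientPowerSeries k).coeff (dimM k) ≠ 0 := by
  have hmap {P : ℚ⟦X⟧} (hP : P.coeff (dimM k) ≠ 0) :
      (P.map (algebraMap ℚ ℂ)).coeff (dimM k) ≠ 0 := by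
    rwa [PowerSeries.coeff_map, map_ne_zero]
  obtain ⟨h2, hw⟩ := weight_cases hk
  rcases Nat.eq_zero_or_pos (dimM k) with hr | hr
  · rcases hw with hw | hw
    · rw [quotientPowerSeries, hw, hr, eisenstein_zero, qExpansion_one]
      simp
    · obtain ⟨w, hw'⟩ : ∃ w : ℕ, weight k = w := ⟨(weight k).toNat, by omega⟩
      rw [quotientPowerSeries_eq_map (by omega) (by rw [hw'] at h2; exact_mod_cast h2) hw']
      apply hmap
      simp [hr, constantCoeff_e]
  · have hkpos : 0 < k := by
      by_contra! h
      rw [dimM_of_neg (lt_of_le_of_ne h hk0)] at hr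
      exact hr.false
    -- Weight 14 occurs only for `12 ∣ k`. Then `k > 0` forces `r ≥ 2`, which excludes the vanishing
    -- case `n = 3 = 3r`.
    obtain ⟨w, hw', hr2⟩ : ∃ w : ℕ, weight k = w ∧ (w = 0 ∨ w = 4 ∨ w = 6 ∨ w = 8 ∨ w = 10 ∨
        (w = 14 ∧ 2 ≤ dimM k)) := by
      refine ⟨(weight k).toNat, by omega, ?_⟩
      lift k to ℕ using hkpos.le
      have hd := dimM_natCast (by exact_mod_cast hk : Even k)
      rw [weight] at *
      obtain ⟨j, hj⟩ := hk
      split_ifs at hd with h12 <;> rw [Nat.ModEq] at h12 <;> omega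
    have hV := coeff_pow_pos coeff_v_pos hr.ne'
    have h4 := coeff_e_four_pos
    rcases hr2 with rfl | rfl | rfl | rfl | rfl | ⟨rfl, hr2⟩
    · rw [quotientPowerSeries, hw', Nat.cast_zero, eisenstein_zero, qExpansion_one, one_mul,
        ← map_v, ← map_pow]
      exact hmap (hV _).ne'
    all_goals
      rw [quotientPowerSeries_eq_map (by norm_num) (by decide) hw']
      apply hmap
    · exact (coeff_mul_pos h4 hV _).ne'
    · simpa using coeff_e_four_pow_mul_e_six_ne_zero (n := 0) hr.ne' (by omega)
    · rw [e_eight]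
      exact (coeff_mul_pos (coeff_pow_pos h4 two_ne_zero) hV _).ne'
    · rw [e_ten]
      simpa using coeff_e_four_pow_mul_e_six_ne_zero (n := 1) hr.ne' (by omega)
    · rw [e_fourteen]
      exact coeff_e_four_pow_mul_e_six_ne_zero (n := 2) hr.ne' (by omega)

/-! ### Convergence of the Laurent expansion and the linear relation. -/

/-- The Laurent expansion of `E_{12 r - k + 2} / Δ ^ r`. -/
lemma hasSum_c {k : ℤ} (hk : Even k) (τ : ℍ) : HasSum
    (fun m : ℕ ↦ c k ((m : ℤ) - dimM k) * q τ ^ ((m : ℤ) - dimM k))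
    (eisenstein (weight k) τ / ModularForm.discriminant τ ^ dimM k) := by
  obtain ⟨g, hg⟩ := exists_modularForm_eq_eisenstein hk
  have h := ((hasQSeries_modularForm g).mul (hasQSeries_discriminantInv.pow (dimM k))) τ
  rw [hg] at h
  have hval : eisenstein (weight k) τ / ModularForm.discriminant τ ^ dimM k =
      (eisenstein (weight k) * (q / ModularForm.discriminant) ^ dimM k) τ *
        q τ ^ (-(dimM k : ℤ)) := by
    have := ModularForm.discriminant_ne_zero τ
    have := q_ne_zero τ
    simp only [Pi.mul_apply, Pi.pow_apply, Pi.div_apply, div_pow, zpow_neg, zpow_natCast]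
    field_simp
  rw [hval]
  convert! h.mul_right (q τ ^ (-(dimM k : ℤ))) using 2 with m
  rw [c_eq, sub_eq_add_neg, zpow_add₀ (q_ne_zero τ), zpow_natCast, ← mul_assoc,
    quotientPowerSeries]

/-- Siegel's linear relation between the Fourier coefficients of a modular form. -/
lemma sum_c_mul_a {k : ℤ} (hk : Even k) (f : ModularForm 𝒮ℒ k) :
    ∑ n ∈ Finset.Icc 0 (dimM k), c k (-(n : ℤ)) * a f n = 0 := by
  obtain ⟨g, hg⟩ := exists_modularForm_eq_eisenstein hk
  have h := coeff_mul_discriminantInv_pow_eq_zero (dimM k) (by rw [weight]; ring) (f.mul g)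
  rw [ModularForm.qExpansion_mul one_pos one_mem_strictPeriods_SL, hg, mul_assoc,
    ← quotientPowerSeries, PowerSeries.coeff_mul, Finset.Nat.sum_antidiagonal_eq_sum_range_succ
      (fun i j ↦ (qExpansion 1 f).coeff i * (quotientPowerSeries k).coeff j)] at h
  rw [← h, ← Nat.range_succ_eq_Icc_zero]
  refine Finset.sum_congr rfl fun n hn ↦ ?_
  rw [c_neg_eq k (Finset.mem_range_succ_iff.mp hn), a, mul_comm]

end SiegelRelation

theorem mainTheorem12 (k : ℤ) (hk : Even k) :
    -- the numbers `c k i`, `i ≥ -r`, are the coefficients of `E_{12 r - k + 2} / Δ ^ r`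
    (∀ τ : ℍ, HasSum
      (fun m : ℕ ↦ SiegelRelation.c k ((m : ℤ) - SiegelRelation.dimM k) *
        SiegelRelation.q τ ^ ((m : ℤ) - SiegelRelation.dimM k))
      (SiegelRelation.eisenstein (12 * (SiegelRelation.dimM k : ℤ) - k + 2) τ /
        ModularForm.discriminant τ ^ SiegelRelation.dimM k)) ∧
    -- the linear relation
    (∀ f : ModularForm 𝒮ℒ k,
      ∑ n ∈ Finset.Icc 0 (SiegelRelation.dimM k),
        SiegelRelation.c k (-(n : ℤ)) * SiegelRelation.a f n = 0) ∧
    -- the constant coefficient does not vanish, and `a(0)` is a rational linear combination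
    (k ≠ 0 →
      SiegelRelation.c k 0 ≠ 0 ∧
      ∃ s : ℕ → ℚ,
        (∀ n ∈ Finset.Icc 1 (SiegelRelation.dimM k),
          (s n : ℂ) = -(SiegelRelation.c k (-(n : ℤ)) / SiegelRelation.c k 0)) ∧
        ∀ f : ModularForm 𝒮ℒ k,
          SiegelRelation.a f 0 =
            ∑ n ∈ Finset.Icc 1 (SiegelRelation.dimM k), (s n : ℂ) * SiegelRelation.a f n) := by
  refine ⟨SiegelRelation.hasSum_c hk, SiegelRelation.sum_c_mul_a hk, fun hk0 ↦ ?_⟩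
  have h0 : SiegelRelation.c k 0 ≠ 0 := by
    have h := SiegelRelation.c_neg_eq k (n := 0) (Nat.zero_le _)
    rw [Nat.cast_zero, neg_zero, Nat.sub_zero] at h
    exact h ▸ SiegelRelation.coeff_quotientPowerSeries_ne_zero hk hk0
  -- A rational model `P` of the quotient supplies the rational weights `s n` as ratios of its
  -- coefficients.
  obtain ⟨P, hP⟩ := SiegelRelation.exists_map_eq_quotientPowerSeries hk
  have hc (n : ℕ) (hn : n ≤ SiegelRelation.dimM k) : SiegelRelation.c k (-(n : ℤ)) =
      (P.coeff (SiegelRelation.dimM k - n) : ℂ) := by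
    rw [SiegelRelation.c_neg_eq k hn, ← hP, PowerSeries.coeff_map, eq_ratCast]
  have hc0 : SiegelRelation.c k 0 = (P.coeff (SiegelRelation.dimM k) : ℂ) := by
    simpa using hc 0 (Nat.zero_le _)
  have hs (n : ℕ) (hn : n ≤ SiegelRelation.dimM k) :
      ((-(P.coeff (SiegelRelation.dimM k - n) / P.coeff (SiegelRelation.dimM k)) : ℚ) : ℂ) =
        -(SiegelRelation.c k (-(n : ℤ)) / SiegelRelation.c k 0) := by
    rw [hc n hn, hc0]
    push_cast
    rfl
  refine ⟨h0, fun n ↦ -(P.coeff (SiegelRelation.dimM k - n) / P.coeff (SiegelRelation.dimM k)),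
    fun n hn ↦ hs n (Finset.mem_Icc.mp hn).2, fun f ↦ ?_⟩
  have h := SiegelRelation.sum_c_mul_a hk f
  rw [← Finset.add_sum_Ioc_eq_sum_Icc (Nat.zero_le _), Nat.cast_zero, neg_zero] at h
  refine mul_left_cancel₀ h0 ?_
  rw [eq_neg_of_add_eq_zero_left h, Finset.mul_sum, ← Finset.sum_neg_distrib]
  refine Finset.sum_congr rfl fun n hn ↦ ?_
  rw [hs n (Finset.mem_Ioc.mp hn).2]
  field_simp
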